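/- A measure on $\mathbb{R}$ is called admissible if it is non-negative and has finite moments $s_k(\mu)=\int_{\mathbb{R}} x^k\,d\mu(x)$ of all orders $k\ge 0$. For $K\subset\mathbb{R}$ let $\mathcal{M}(K)$ denote the set of moment sequences $(s_k(\mu))_{k\ge 0}$ of the admissible measures $\mu$ supported on $K$ (that is, with $\mu(\mathbb{R}\setminus K)=0$). A function $F:[0,\infty)\to\mathbb{R}$ acts entrywise on sequences with entries in $[0,\infty)$ by $(s_k)_{k\ge0}\mapsto(F(s_k))_{k\ge0}$. An absolutely monotonic entire function is an entire function whose Taylor coefficients at every point of $(0,\infty)$ are non-negative real numbers. Theorem. Fix $u_0\in(0,1)$. Given a function $F:[0,\infty)\to\mathbb{R}$, the following are equivalent. (1) Applied entrywise, $F$ maps $\mathcal{M}(\{1,u_0\})\cup\mathcal{M}(\{0,1\})$ into $\mathcal{M}(\mathbb{R})$, and $F(a)F(b)\ge F(\sqrt{ab})^2$ for all $a,b\ge 0$. (2) Applied entrywise, $F$ maps $\mathcal{M}([0,1])$ into itself. (3) $F$ agrees on $(0,\infty)$ with an absolutely monotonic entire function, and $0\le F(0)\le\lim_{\epsilon\to0^+}F(\epsilon)$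 (where the limit exists and is finite). Moreover, if $F$ is continuous on $(0,\infty)$, then the second hypothesis in (1) may be omitted: in that case (2) and (3) are each equivalent to the condition that, applied entrywise, $F$ maps $\mathcal{M}(\{1,u_0\})\cup\mathcal{M}(\{0,1\})$ into $\mathcal{M}(\mathbb{R})$. -/

import Mathlib

open scoped NNReal Topology
open MeasureTheory

/-- A non-negative measure on `ℝ` that has moments of all orders. -/
def AdmissibleMeasure (μ : Measure ℝ) : Prop :=
  ∀ k : ℕ, Integrable (fun x : ℝ => x ^ k) μ

/-- The set of moment sequences `(s₀, s₁, s₂, …)` of the admissible measures supported on `K`,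
i.e. giving no mass to the complement of `K`. -/
def momentSequences (K : Set ℝ) : Set (ℕ → ℝ) :=
  {s | ∃ μ : Measure ℝ, AdmissibleMeasure μ ∧ μ Kᶜ = 0 ∧ ∀ k : ℕ, s k = ∫ x, x ^ k ∂μ}

/-- Applied entrywise, `F : [0, ∞) → ℝ` maps the set `S` of real sequences into `T`: every
sequence in `S` has its entries in the domain `[0, ∞)` of `F`, and its entrywise image lies
in `T`. -/
def MapsEntrywise (F : ℝ≥0 → ℝ) (S T : Set (ℕ → ℝ)) : Prop :=
  ∀ s ∈ S, ∃ t : ℕ → ℝ≥0, (∀ k, (t k : ℝ) = s k) ∧ (fun k => F (t k)) ∈ T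

/-- An absolutely monotonic entire function: an entire function whose Taylor coefficients at
every point of `(0, ∞)` are non-negative real numbers. -/
def IsAbsolutelyMonotonicEntire (G : ℂ → ℂ) : Prop :=
  Differentiable ℂ G ∧
    ∀ x : ℝ, 0 < x → ∀ n : ℕ, ∃ c : ℝ, 0 ≤ c ∧ iteratedDeriv n G (x : ℂ) / (n.factorial : ℂ) = c

/-!
For (1) ⇒ (3), the image under `F` of the moments of `a δ₁ + b δᵤ` is `k ↦ F (a + b u ^ k)`, so the
linear functional sending `X ^ k` to `F (a + b u ^ k)` is nonnegative on squares of polynomials.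
Evaluated at the square of `∏ j < n, (X - u ^ j)`, it kills all Taylor terms of `F` at `a` of order
below `n`; dividing by `b ^ n` and letting `b → 0⁺` gives `F⁽ⁿ⁾ a ≥ 0` whenever `F` is smooth.
If `F` is merely continuous on `(0, ∞)`, its mollifications inherit the positivity, hence are sums
of power series with nonnegative coefficients by Bernstein's theorem, and so is their pointwise
limit. Continuity follows from `F a * F b ≥ F (√(a b)) ^ 2`: the measures on `{0, 1}` make `F`
nonnegative and monotone, and this inequality then rules out jumps.

For (3) ⇒ (2), products of moments are moments of multiplicative convolutions, and convergent sums
of moments are moments of sums of measures, so nonnegative power series preserve moment sequences.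
-/

open Filter

/-- `f` agrees on `(0, ∞)` with the sum of an everywhere convergent power series with nonnegative
coefficients; this is absolute monotonicity on `(0, ∞)` with no condition on `f` elsewhere. -/
def HasNonnegPowerSeries (f : ℝ → ℝ) : Prop :=
  ∃ c : ℕ → ℝ, (∀ n, 0 ≤ c n) ∧ ∀ x, 0 < x → HasSum (fun n => c n * x ^ n) (f x)

theorem HasNonnegPowerSeries.monotoneOn {f : ℝ → ℝ} (hf : HasNonnegPowerSeries f) :
    MonotoneOn f (Set.Ioi 0) := fun x hx y hy hxy => by
  obtain ⟨c, hc, hsum⟩ := hf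
  exact hasSum_le (fun n => mul_le_mul_of_nonneg_left (pow_le_pow_left₀ (le_of_lt hx) hxy n) (hc n))
    (hsum x hx) (hsum y hy)

theorem HasNonnegPowerSeries.of_tendsto {g : ℕ → ℝ → ℝ} {f : ℝ → ℝ}
    (hg : ∀ N, HasNonnegPowerSeries (g N))
    (hlim : ∀ x, 0 < x → Tendsto (fun N => g N x) atTop (𝓝 (f x))) :
    HasNonnegPowerSeries f := by
  choose c hc hsum using hg
  have bounded : ∀ x, 0 < x → ∃ M, ∀ N k, c N k * x ^ k ≤ M := fun x hx => by
    obtain ⟨M, hM⟩ := (hlim x hx).bddAbove_range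
    exact ⟨M, fun N k => (le_hasSum (hsum N x hx) k fun j _ => mul_nonneg (hc N j) (by positivity))
      |>.trans (hM ⟨N, rfl⟩)⟩
  obtain ⟨M, hM⟩ := bounded 1 one_pos
  obtain ⟨l, hl, φ, hφ, hcl⟩ := (isCompact_univ_pi fun _ : ℕ => isCompact_Icc (a := 0) (b := M))
    |>.tendsto_subseq (x := c) fun N k _ => ⟨hc N k, by simpa using hM N k⟩
  simp only [tendsto_pi_nhds, Function.comp_apply] at hcl
  refine ⟨l, fun k => (hl k trivial).1, fun x hx => ?_⟩
  obtain ⟨B, hB⟩ := bounded (2 * x) (by positivity)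
  have dominated : ∀ N k, ‖c (φ N) k * x ^ k‖ ≤ B * (1 / 2) ^ k := fun N k => by
    rw [Real.norm_of_nonneg (mul_nonneg (hc _ k) (by positivity))]
    calc c (φ N) k * x ^ k = c (φ N) k * (2 * x) ^ k * (1 / 2) ^ k := by
          rw [mul_assoc, ← mul_pow]; ring_nf
      _ ≤ B * (1 / 2) ^ k := by gcongr; exact hB _ k
  have summable_bound := summable_geometric_two.mul_left B
  have summable_limit : Summable fun k => l k * x ^ k :=
    .of_norm_bounded summable_bound fun k =>
      le_of_tendsto' ((hcl k).mul_const (x ^ k)).norm fun N => dominated N k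
  have tendsto_sum : Tendsto (fun N => g (φ N) x) atTop (𝓝 (∑' k, l k * x ^ k)) := by
    simpa only [(hsum _ x hx).tsum_eq] using
      tendsto_tsum_of_dominated_convergence summable_bound (fun k => (hcl k).mul_const (x ^ k))
        (.of_forall dominated)
  rw [tendsto_nhds_unique ((hlim x hx).comp hφ.tendsto_atTop) tendsto_sum]
  exact summable_limit.hasSum

open scoped ContDiff in
theorem exists_eq_taylor_add_lagrange_remainder {f : ℝ → ℝ} {s : Set ℝ} (hf : ContDiffOn ℝ ∞ f s)
    (hs : UniqueDiffOn ℝ s) {x y : ℝ} (hxy : x < y) (hsub : Set.Icc x y ⊆ s) (n : ℕ) :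
    ∃ ξ ∈ Set.Ioo x y, f y =
      ∑ k ∈ Finset.range (n + 1), iteratedDerivWithin k f s x / k.factorial * (y - x) ^ k +
        iteratedDerivWithin (n + 1) f s ξ / (n + 1).factorial * (y - x) ^ (n + 1) := by
  have unique : UniqueDiffOn ℝ (Set.uIcc x y) := uniqueDiffOn_uIcc hxy.ne
  rw [← Set.uIcc_of_lt hxy] at hsub
  have restrict : ∀ k, ∀ z ∈ Set.uIcc x y,
      iteratedDerivWithin k f (Set.uIcc x y) z = iteratedDerivWithin k f s z := fun k z hz => by
    simp only [iteratedDerivWithin]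
    rw [iteratedFDerivWithin_subset hsub unique hs (hf.of_le (mod_cast le_top)) hz]
  obtain ⟨ξ, hξ, h⟩ := taylor_mean_remainder_lagrange (n := n) hxy.ne
    ((hf.mono hsub).of_le (mod_cast le_top))
    (((hf.mono hsub).differentiableOn_iteratedDerivWithin
      (mod_cast WithTop.coe_lt_top _) unique).mono Set.uIoo_subset_uIcc_self)
  rw [restrict _ ξ (Set.uIoo_subset_uIcc_self hξ), sub_eq_iff_eq_add', taylor_within_apply] at h
  refine ⟨ξ, Set.uIoo_of_lt hxy ▸ hξ, h.trans ?_⟩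
  congr 1
  · refine Finset.sum_congr rfl fun k _ => ?_
    rw [restrict k x Set.left_mem_uIcc, smul_eq_mul]
    ring
  · ring

section AbsolutelyMonotoneOn

variable {f : ℝ → ℝ} {a : ℝ}

theorem taylorTerm_le_of_absolutelyMonotoneOn_Ici (hf : AbsolutelyMonotoneOn f (Set.Ici a))
    {x y : ℝ} (hx : a ≤ x) (hxy : x ≤ y) (n : ℕ) :
    iteratedDerivWithin n f (Set.Ici a) x / n.factorial * (y - x) ^ n ≤ f y := by
  have nonneg : ∀ k z, a ≤ z → 0 ≤ iteratedDerivWithin k f (Set.Ici a) z := fun k _ =>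
    hf.iteratedDerivWithin_nonneg (uniqueDiffOn_Ici a) k
  rcases hxy.eq_or_lt with rfl | hlt
  · rcases n with - | n
    · simp
    · simpa using nonneg 0 x hx
  obtain ⟨ξ, hξ, h⟩ := exists_eq_taylor_add_lagrange_remainder hf.contDiffOn
    (uniqueDiffOn_Ici a) hlt (fun z hz => hx.trans hz.1) n
  have terms_nonneg : ∀ k z, a ≤ z →
      0 ≤ iteratedDerivWithin k f (Set.Ici a) z / k.factorial * (y - x) ^ k := fun k z hz =>
    mul_nonneg (div_nonneg (nonneg k z hz) (by positivity)) (pow_nonneg (sub_nonneg.2 hxy) k)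
  rw [h]
  exact (Finset.single_le_sum (fun k _ => terms_nonneg k x hx) (Finset.self_mem_range_succ n)).trans
    (le_add_of_nonneg_right (terms_nonneg _ ξ (hx.trans hξ.1.le)))

theorem monotoneOn_of_absolutelyMonotoneOn_Ici (hf : AbsolutelyMonotoneOn f (Set.Ici a)) :
    MonotoneOn f (Set.Ici a) := fun x hx y _ hxy => by
  simpa using taylorTerm_le_of_absolutelyMonotoneOn_Ici hf hx hxy 0

theorem taylorTerm_le_mul_half_pow_of_absolutelyMonotoneOn_Ici
    (hf : AbsolutelyMonotoneOn f (Set.Ici a)) {x h : ℝ} (hx : a ≤ x) (hh : 0 ≤ h) (n : ℕ) :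
    iteratedDerivWithin n f (Set.Ici a) x / n.factorial * h ^ n ≤ f (x + 2 * h) * (1 / 2) ^ n :=
  calc iteratedDerivWithin n f (Set.Ici a) x / n.factorial * h ^ n
    _ = iteratedDerivWithin n f (Set.Ici a) x / n.factorial * (x + 2 * h - x) ^ n *
        (1 / 2) ^ n := by rw [mul_assoc _ (_ ^ _), ← mul_pow]; ring_nf
    _ ≤ f (x + 2 * h) * (1 / 2) ^ n := by
      gcongr
      exact taylorTerm_le_of_absolutelyMonotoneOn_Ici hf hx (by linarith) n

theorem hasNonnegPowerSeries_of_absolutelyMonotoneOn_Ici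
    (hf : AbsolutelyMonotoneOn f (Set.Ici a)) : HasNonnegPowerSeries fun x => f (a + x) := by
  have nonneg : ∀ n z, a ≤ z → 0 ≤ iteratedDerivWithin n f (Set.Ici a) z / n.factorial :=
    fun n z hz => div_nonneg (hf.iteratedDerivWithin_nonneg (uniqueDiffOn_Ici a) n hz)
      (by positivity)
  refine ⟨fun n => iteratedDerivWithin n f (Set.Ici a) a / n.factorial,
    fun n => nonneg n a le_rfl, fun x hx => ?_⟩
  rw [hasSum_iff_tendsto_nat_of_nonneg fun n => mul_nonneg (nonneg n a le_rfl) (by positivity),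
    ← tendsto_add_atTop_iff_nat 1]
  have partialSum_bounds : ∀ n : ℕ, f (a + x) - f (a + 3 * x) * (1 / 2) ^ (n + 1) ≤
      ∑ k ∈ Finset.range (n + 1), iteratedDerivWithin k f (Set.Ici a) a / k.factorial * x ^ k ∧
      ∑ k ∈ Finset.range (n + 1), iteratedDerivWithin k f (Set.Ici a) a / k.factorial * x ^ k ≤
        f (a + x) := fun n => by
    obtain ⟨ξ, ⟨haξ, hξ⟩, taylor⟩ := exists_eq_taylor_add_lagrange_remainder hf.contDiffOn
      (uniqueDiffOn_Ici a) (lt_add_of_pos_right a hx) (fun z hz => hz.1) n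
    rw [add_sub_cancel_left] at taylor
    have remainder_le :
        iteratedDerivWithin (n + 1) f (Set.Ici a) ξ / (n + 1).factorial * x ^ (n + 1) ≤
          f (a + 3 * x) * (1 / 2) ^ (n + 1) := by
      refine (taylorTerm_le_mul_half_pow_of_absolutelyMonotoneOn_Ici hf haξ.le hx.le _).trans ?_
      gcongr
      exact monotoneOn_of_absolutelyMonotoneOn_Ici hf (by simp; linarith) (by simp; linarith)
        (by linarith)
    have := mul_nonneg (nonneg (n + 1) ξ haξ.le) (pow_nonneg hx.le (n + 1))
    constructor <;> linarith
  refine tendsto_of_tendsto_of_tendsto_of_le_of_le ?_ tendsto_const_nhds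
    (fun n => (partialSum_bounds n).1) fun n => (partialSum_bounds n).2
  have geometric := tendsto_pow_atTop_nhds_zero_of_lt_one (r := (1 / 2 : ℝ)) (by norm_num)
    (by norm_num)
  simpa using (((tendsto_add_atTop_iff_nat 1).2 geometric).const_mul (f (a + 3 * x))).const_sub
    (f (a + x))

end AbsolutelyMonotoneOn

section RieszFunctional

open Polynomial

/-- The Riesz functional of a sequence `s`: the linear functional on real polynomials sending
`X ^ k` to `s k`. For a moment sequence it is integration against the measure. -/
noncomputable def rieszFunctional (s : ℕ → ℝ) : ℝ[X] →ₗ[ℝ] ℝ :=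
  lsum fun k => LinearMap.mulRight ℝ (s k)

theorem rieszFunctional_apply (s : ℕ → ℝ) (p : ℝ[X]) :
    rieszFunctional s p = ∑ k ∈ p.support, p.coeff k * s k := rfl

@[simp]
theorem rieszFunctional_C_mul_X_pow (s : ℕ → ℝ) (c : ℝ) (k : ℕ) :
    rieszFunctional s (C c * X ^ k) = c * s k := by
  simp [rieszFunctional, C_mul_X_pow_eq_monomial, sum_monomial_index]

theorem rieszFunctional_pow (x : ℝ) (p : ℝ[X]) : rieszFunctional (fun k => x ^ k) p = p.eval x :=
  (eval_eq_sum ..).symm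

theorem rieszFunctional_integral {α : Type*} [MeasurableSpace α] {μ : Measure α} {f : ℕ → α → ℝ}
    (hf : ∀ k, Integrable (f k) μ) (p : ℝ[X]) :
    rieszFunctional (fun k => ∫ t, f k t ∂μ) p = ∫ t, rieszFunctional (fun k => f k t) p ∂μ := by
  simp only [rieszFunctional_apply, ← integral_const_mul]
  exact (integral_finsetSum _ fun k _ => (hf k).const_mul _).symm

theorem rieszFunctional_sq_nonneg {K : Set ℝ} {s : ℕ → ℝ} (hs : s ∈ momentSequences K)
    (q : ℝ[X]) : 0 ≤ rieszFunctional s (q ^ 2) := by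
  obtain ⟨μ, hμ, -, hsμ⟩ := hs
  rw [funext hsμ, rieszFunctional_integral hμ]
  simp only [rieszFunctional_pow, eval_pow]
  exact integral_nonneg fun x => sq_nonneg _

theorem hankel_quadratic_nonneg {K : Set ℝ} {s : ℕ → ℝ} (hs : s ∈ momentSequences K) (x : ℝ) :
    0 ≤ s 0 * (x * x) + 2 * s 1 * x + s 2 := by
  have expand : (C x + X) ^ 2 = C (x * x) * X ^ 0 + C (2 * x) * X ^ 1 + C 1 * X ^ 2 := by
    simp only [map_mul, map_ofNat, map_one]
    ring
  have := rieszFunctional_sq_nonneg hs (C x + X)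
  rw [expand] at this
  simp only [map_add, rieszFunctional_C_mul_X_pow] at this
  linarith

theorem sq_le_mul_of_mem_momentSequences {K : Set ℝ} {s : ℕ → ℝ} (hs : s ∈ momentSequences K) :
    s 1 ^ 2 ≤ s 0 * s 2 := by
  have := discrim_le_zero (hankel_quadratic_nonneg hs)
  rw [discrim] at this
  linarith

/- The coefficient of `b ^ j` pairs with `p` to a multiple of `p.eval (u ^ j)`, so that only the top
order term survives. -/
theorem rieszFunctional_taylorWithinEval {u : ℝ} {p : ℝ[X]} {n : ℕ}
    (hp : ∀ j < n, p.eval (u ^ j) = 0) (g : ℝ → ℝ) (a b : ℝ) :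
    rieszFunctional (fun k => taylorWithinEval g n Set.univ a (a + b * u ^ k)) p =
      iteratedDeriv n g a / n.factorial * p.eval (u ^ n) * b ^ n := by
  have term : ∀ j, ∑ k ∈ p.support, p.coeff k *
      ((j.factorial : ℝ)⁻¹ * (a + b * u ^ k - a) ^ j * iteratedDeriv j g a) =
      iteratedDeriv j g a / j.factorial * p.eval (u ^ j) * b ^ j := fun j => by
    rw [eval_eq_sum, Polynomial.sum, Finset.mul_sum, Finset.sum_mul]
    refine Finset.sum_congr rfl fun k _ => ?_
    ring
  simp only [rieszFunctional_apply, taylor_within_apply, smul_eq_mul, Finset.mul_sum,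
    iteratedDerivWithin_univ]
  rw [Finset.sum_comm, Finset.sum_congr rfl fun j _ => term j, Finset.sum_range_succ,
    Finset.sum_eq_zero fun j hj => by rw [hp j (Finset.mem_range.1 hj)]; ring, zero_add]

theorem tendsto_rieszFunctional_div_pow {g : ℝ → ℝ} {n : ℕ} (hg : ContDiff ℝ n g) {u : ℝ}
    {p : ℝ[X]} (hp : ∀ j < n, p.eval (u ^ j) = 0) (a : ℝ) :
    Tendsto (fun b => rieszFunctional (fun k => g (a + b * u ^ k)) p / b ^ n) (𝓝[>] 0)
      (𝓝 (iteratedDeriv n g a / n.factorial * p.eval (u ^ n))) := by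
  let R : ℝ → ℝ := fun x => g x - taylorWithinEval g n Set.univ a x
  have remainder : Tendsto (fun b => ∑ k ∈ p.support, p.coeff k * (R (a + b * u ^ k) / b ^ n))
      (𝓝[>] 0) (𝓝 (∑ _k ∈ p.support, 0)) := by
    refine tendsto_finsetSum _ fun k _ => ?_
    have little_o := (taylor_isLittleO_univ hg (x₀ := a)).comp_tendsto
      (k := fun b : ℝ => a + b * u ^ k) (l' := 𝓝[>] 0)
      ((Continuous.tendsto' (by fun_prop) _ _ (by simp)).mono_left nhdsWithin_le_nhds)
    have step_bound : (fun b : ℝ => (a + b * u ^ k - a) ^ n) =O[𝓝[>] 0] fun b => b ^ n := by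
      simpa [mul_pow, mul_comm] using
        (Asymptotics.isBigO_refl (fun b : ℝ => b ^ n) (𝓝[>] 0)).const_mul_left ((u ^ k) ^ n)
    simpa using ((little_o.trans_isBigO step_bound).tendsto_div_nhds_zero).const_mul (p.coeff k)
  have shifted := remainder.add_const (iteratedDeriv n g a / n.factorial * p.eval (u ^ n))
  rw [Finset.sum_const_zero, zero_add] at shifted
  refine shifted.congr' (eventually_nhdsWithin_of_forall fun b (hb : 0 < b) => ?_)
  have hbn := (pow_pos hb n).ne'
  rw [eq_div_iff hbn, add_mul, ← rieszFunctional_taylorWithinEval hp]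
  simp only [R, rieszFunctional_apply, Finset.sum_mul, ← Finset.sum_add_distrib]
  refine Finset.sum_congr rfl fun k _ => ?_
  field_simp
  ring

/-- Nonnegativity on squares of the Riesz functionals of the sequences `k ↦ f (a + b * u ^ k)`,
`b > 0`, the image under `f` of the moments of the measures `a δ₁ + b δᵤ`. Equivalently, the Hankel
matrices of these sequences are positive semidefinite. -/
def HankelNonnegAt (u : ℝ) (f : ℝ → ℝ) (a : ℝ) : Prop :=
  ∀ b, 0 < b → ∀ q : ℝ[X], 0 ≤ rieszFunctional (fun k => f (a + b * u ^ k)) (q ^ 2)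

theorem HankelNonnegAt.iteratedDeriv_nonneg {u : ℝ} (hu : Function.Injective fun k : ℕ => u ^ k)
    {g : ℝ → ℝ} {n : ℕ} (hg : ContDiff ℝ n g) {a : ℝ} (h : HankelNonnegAt u g a) :
    0 ≤ iteratedDeriv n g a := by
  let q : ℝ[X] := ∏ j ∈ Finset.range n, (X - C (u ^ j))
  have vanishes : ∀ j < n, (q ^ 2).eval (u ^ j) = 0 := fun j hj => by
    have : q.eval (u ^ j) = 0 := by
      rw [eval_prod]
      exact Finset.prod_eq_zero (Finset.mem_range.2 hj) (by simp)
    simp [this]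
  have pos : 0 < (q ^ 2).eval (u ^ n) := by
    have : q.eval (u ^ n) ≠ 0 := by
      rw [eval_prod]
      refine Finset.prod_ne_zero_iff.2 fun j hj => ?_
      simpa [sub_eq_zero] using hu.ne (Finset.mem_range.1 hj).ne'
    rw [eval_pow]
    positivity
  have limit_nonneg := ge_of_tendsto (tendsto_rieszFunctional_div_pow hg vanishes a)
    (eventually_nhdsWithin_of_forall fun b hb => div_nonneg (h b hb q) (pow_pos hb n).le)
  have := (le_div_iff₀ (by positivity)).1 (nonneg_of_mul_nonneg_left limit_nonneg pos)
  rwa [zero_mul] at this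

open scoped Convolution

theorem HankelNonnegAt.convolution {u a : ℝ} {φ f : ℝ → ℝ} {μ : Measure ℝ}
    (hφ : ∀ t, 0 ≤ φ t) (hφf : ConvolutionExists φ f (ContinuousLinearMap.lsmul ℝ ℝ) μ)
    (h : ∀ t ∈ Function.support φ, HankelNonnegAt u f (a - t)) :
    HankelNonnegAt u (φ ⋆[ContinuousLinearMap.lsmul ℝ ℝ, μ] f) a := fun b hb q => by
  simp only [MeasureTheory.convolution_def]
  rw [rieszFunctional_integral fun k => hφf _]
  refine integral_nonneg fun t => ?_
  have factor : rieszFunctional (fun k => φ t * f (a + b * u ^ k - t)) (q ^ 2) =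
      φ t * rieszFunctional (fun k => f (a - t + b * u ^ k)) (q ^ 2) := by
    simp only [rieszFunctional_apply, Finset.mul_sum, sub_add_eq_add_sub, mul_left_comm]
  refine factor.symm ▸ ?_
  by_cases ht : φ t = 0
  · simp [ht]
  · exact mul_nonneg (hφ t) (h t ht b hb q)

theorem hasNonnegPowerSeries_of_hankelNonnegAt {u : ℝ}
    (hu : Function.Injective fun k : ℕ => u ^ k) {f : ℝ → ℝ} (hloc : LocallyIntegrable f)
    (hcont : ContinuousOn f (Set.Ioi 0)) (h : ∀ a, 0 < a → HankelNonnegAt u f a) :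
    HasNonnegPowerSeries f := by
  let φ : ℕ → ContDiffBump (0 : ℝ) := fun i =>
    ⟨1 / (i + 1) / 2, 1 / (i + 1), by positivity, half_lt_self (by positivity)⟩
  let g : ℕ → ℝ → ℝ := fun i =>
    (φ i).normed volume ⋆[ContinuousLinearMap.lsmul ℝ ℝ, volume] f
  have rOut_tendsto : Tendsto (fun i => (φ i).rOut) atTop (𝓝 0) :=
    tendsto_one_div_add_atTop_nhds_zero_nat
  have g_smooth : ∀ i, ContDiff ℝ (⊤ : ℕ∞) (g i) := fun i =>
    (φ i).hasCompactSupport_normed.contDiff_convolution_left _ (φ i).contDiff_normed hloc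
  have g_hankel : ∀ i, ∀ y ∈ Set.Ici (φ i).rOut, HankelNonnegAt u (g i) y := fun i y hy =>
    .convolution (φ i).nonneg_normed
      ((φ i).hasCompactSupport_normed.convolutionExists_left _ (φ i).continuous_normed hloc)
      fun t ht => h _ <| by
        rw [(φ i).support_normed_eq, Metric.mem_ball, dist_zero_right] at ht
        exact sub_pos.2 ((lt_of_abs_lt ht).trans_le hy)
  have g_powerSeries : ∀ i, HasNonnegPowerSeries fun x => g i ((φ i).rOut + x) := fun i =>
    hasNonnegPowerSeries_of_absolutelyMonotoneOn_Ici <| .of_contDiff (g_smooth i) fun n y hy =>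
      (g_hankel i y hy).iteratedDeriv_nonneg hu ((g_smooth i).of_le (mod_cast le_top))
  refine .of_tendsto g_powerSeries fun x hx => ?_
  exact ContDiffBump.convolution_tendsto_right rOut_tendsto
    (.of_forall fun _ => hloc.aestronglyMeasurable)
    ((hcont.continuousAt (Ioi_mem_nhds hx)).tendsto.comp tendsto_snd)
    (by simpa using rOut_tendsto.add_const x)

end RieszFunctional

section Entire

open scoped ComplexOrder

theorem exists_nonneg_div_factorial_eq_ofReal_iff {z : ℂ} (n : ℕ) :
    (∃ c : ℝ, 0 ≤ c ∧ z / n.factorial = c) ↔ 0 ≤ z := by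
  have factorial_ne_zero : (n.factorial : ℂ) ≠ 0 := mod_cast n.factorial_ne_zero
  constructor
  · rintro ⟨c, hc, h⟩
    rw [(div_eq_iff factorial_ne_zero).1 h]
    exact mul_nonneg (Complex.zero_le_real.2 hc) (Nat.cast_nonneg _)
  · refine fun hz => ⟨z.re / n.factorial, div_nonneg (Complex.le_def.1 hz).1 (by positivity), ?_⟩
    rw [Complex.eq_re_of_ofReal_le hz]
    simp

theorem isAbsolutelyMonotonicEntire_iff {G : ℂ → ℂ} :
    IsAbsolutelyMonotonicEntire G ↔ Differentiable ℂ G ∧ ∀ n, 0 ≤ iteratedDeriv n G 0 := by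
  simp only [IsAbsolutelyMonotonicEntire, exists_nonneg_div_factorial_eq_ofReal_iff]
  refine and_congr_right fun hG => ⟨fun h n => ?_, fun h x hx n => ?_⟩
  · have continuous : Continuous fun x : ℝ => iteratedDeriv n G x :=
      (hG.contDiff.continuous_iteratedDeriv n le_top).comp Complex.continuous_ofReal
    exact ge_of_tendsto (x := 𝓝[>] (0 : ℝ))
      ((continuous.tendsto' 0 _ (by simp)).mono_left nhdsWithin_le_nhds)
      (eventually_nhdsWithin_of_forall fun x hx => h x hx n)
  · refine (hG.contDiff.differentiable_iteratedDeriv n (WithTop.coe_lt_top _)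
      |>.nonneg_of_iteratedDeriv_nonneg fun m => ?_) (Complex.zero_le_real.2 hx.le)
    rw [iteratedDeriv_eq_iterate, iteratedDeriv_eq_iterate, ← Function.iterate_add_apply,
      ← iteratedDeriv_eq_iterate]
    exact h (m + n)

theorem differentiable_tsum_mul_pow {c : ℕ → ℂ} (hc : ∀ z : ℂ, Summable fun n => c n * z ^ n) :
    Differentiable ℂ (fun z => ∑' n, c n * z ^ n) ∧
      ∀ n, iteratedDeriv n (fun z => ∑' n, c n * z ^ n) 0 = n.factorial * c n := by
  let p : FormalMultilinearSeries ℂ ℂ ℂ := FormalMultilinearSeries.ofScalars ℂ c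
  have radius_eq_top : p.radius = ⊤ := ENNReal.eq_top_of_forall_nnreal_le fun r =>
    p.le_radius_of_summable <| by
      simpa [p, FormalMultilinearSeries.ofScalars_norm] using (hc r).norm
  have hasSum : HasFPowerSeriesOnBall (fun z => ∑' n, c n * z ^ n) p 0 ⊤ :=
    { r_le := radius_eq_top.ge
      r_pos := ENNReal.zero_lt_top
      hasSum := fun {z} _ => by
        simpa [p, FormalMultilinearSeries.ofScalars, mul_comm] using (hc z).hasSum }
  refine ⟨fun z => (hasSum.analyticAt_of_mem (by simp)).differentiableAt, fun n => ?_⟩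
  rw [iteratedDeriv_eq_iteratedFDeriv, ← hasSum.factorial_smul 1 n]
  simp [p, FormalMultilinearSeries.ofScalars]

theorem hasNonnegPowerSeries_iff_exists_entire {f : ℝ → ℝ} :
    HasNonnegPowerSeries f ↔
      ∃ G : ℂ → ℂ, IsAbsolutelyMonotonicEntire G ∧ ∀ x : ℝ, 0 < x → (f x : ℂ) = G x := by
  constructor
  · rintro ⟨c, hc, hsum⟩
    have summable : ∀ z : ℂ, Summable fun n => (c n : ℂ) * z ^ n := fun z => by
      refine .of_norm_bounded (hsum (‖z‖ + 1) (by positivity)).summable fun n => ?_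
      rw [norm_mul, norm_pow, Complex.norm_of_nonneg (hc n)]
      gcongr
      · exact hc n
      · linarith
    obtain ⟨differentiable, taylor⟩ := differentiable_tsum_mul_pow summable
    refine ⟨_, isAbsolutelyMonotonicEntire_iff.2 ⟨differentiable, fun n => ?_⟩, fun x hx => ?_⟩
    · rw [taylor]
      exact mul_nonneg (Nat.cast_nonneg _) (Complex.zero_le_real.2 (hc n))
    · rw [← (hsum x hx).tsum_eq]
      push_cast
      rfl
  · rintro ⟨G, hG, hfG⟩
    obtain ⟨differentiable, nonneg⟩ := isAbsolutelyMonotonicEntire_iff.1 hG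
    refine ⟨fun n => (iteratedDeriv n G 0).re / n.factorial,
      fun n => div_nonneg (Complex.le_def.1 (nonneg n)).1 (by positivity),
      fun x hx => Complex.hasSum_ofReal.1 ?_⟩
    rw [hfG x hx]
    refine (Complex.hasSum_taylorSeries_of_entire differentiable 0 x).congr_fun fun n => ?_
    have real := Complex.eq_re_of_ofReal_le (nonneg n)
    rw [real]
    push_cast
    simp only [smul_eq_mul, sub_zero]
    ring

theorem exists_entire_and_tendsto_iff {F : ℝ≥0 → ℝ} :
    ((∃ G : ℂ → ℂ, IsAbsolutelyMonotonicEntire G ∧ ∀ x : ℝ≥0, 0 < x → (F x : ℂ) = G (x : ℝ)) ∧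
      ∃ L : ℝ, Tendsto F (𝓝[>] 0) (𝓝 L) ∧ 0 ≤ F 0 ∧ F 0 ≤ L) ↔
    (HasNonnegPowerSeries fun x => F x.toNNReal) ∧ 0 ≤ F 0 ∧ ∀ x, F 0 ≤ F x := by
  have entire_iff : (∃ G : ℂ → ℂ, IsAbsolutelyMonotonicEntire G ∧
      ∀ x : ℝ≥0, 0 < x → (F x : ℂ) = G (x : ℝ)) ↔ HasNonnegPowerSeries fun x => F x.toNNReal := by
    rw [hasNonnegPowerSeries_iff_exists_entire]
    refine exists_congr fun G => and_congr_right fun _ => ⟨fun h x hx => ?_, fun h x hx => ?_⟩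
    · rw [h _ (Real.toNNReal_pos.2 hx), Real.coe_toNNReal x hx.le]
    · simpa using h x hx
  rw [entire_iff]
  refine and_congr_right fun hF => ?_
  have mono : MonotoneOn F (Set.Ioi 0) := fun x hx y hy hxy => by
    simpa using hF.monotoneOn (NNReal.coe_pos.2 hx) (NNReal.coe_pos.2 hy) (NNReal.coe_le_coe.2 hxy)
  constructor
  · rintro ⟨L, hL, hF₀, hF₀L⟩
    refine ⟨hF₀, fun x => ?_⟩
    rcases eq_zero_or_pos x with rfl | hx
    · exact le_rfl
    refine hF₀L.trans (le_of_tendsto hL ?_)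
    filter_upwards [Ioo_mem_nhdsGT hx] with y hy using mono hy.1 hx hy.2.le
  · rintro ⟨hF₀, hF_min⟩
    have tendsto := mono.tendsto_nhdsGT ⟨F 0, Set.forall_mem_image.2 fun x _ => hF_min x⟩
    exact ⟨_, tendsto, hF₀, ge_of_tendsto tendsto (.of_forall hF_min)⟩

end Entire

theorem continuousOn_of_monotone_of_sq_sqrt_mul_le {F : ℝ≥0 → ℝ} (hmono : Monotone F)
    (hF₀ : 0 ≤ F 0) (hF : ∀ a b, F (NNReal.sqrt (a * b)) ^ 2 ≤ F a * F b) :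
    ContinuousOn F (Set.Ioi 0) := fun x (hx : 0 < x) => by
  refine ContinuousAt.continuousWithinAt ?_
  rw [hmono.continuousAt_iff_leftLim_eq_rightLim]
  refine le_antisymm (hmono.leftLim_le_rightLim le_rfl) ?_
  set l := Function.leftLim F x
  set r := Function.rightLim F x
  have l_nonneg : 0 ≤ l := hF₀.trans (hmono.le_leftLim hx)
  have r_nonneg : 0 ≤ r := l_nonneg.trans (hmono.leftLim_le_rightLim le_rfl)
  -- `x * t` is the geometric mean of `x / t < x` and `x * t ^ 3`.
  have straddle : ∀ᶠ t : ℝ≥0 in 𝓝[>] 1, r ^ 2 ≤ l * F (x * t ^ 3) := by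
    filter_upwards [self_mem_nhdsWithin] with t (ht : 1 < t)
    have mean : NNReal.sqrt (x / t * (x * t ^ 3)) = x * t := by
      rw [← NNReal.sqrt_sq (x * t)]
      congr 1
      field_simp
    calc r ^ 2 ≤ F (x * t) ^ 2 := by
          gcongr
          exact hmono.rightLim_le (lt_mul_of_one_lt_right hx ht)
      _ ≤ F (x / t) * F (x * t ^ 3) := mean ▸ hF _ _
      _ ≤ l * F (x * t ^ 3) := by
          gcongr
          · exact hF₀.trans (hmono zero_le)
          · exact hmono.le_leftLim (div_lt_self hx ht)
  have limit : Tendsto (fun t : ℝ≥0 => l * F (x * t ^ 3)) (𝓝[>] 1) (𝓝 (l * r)) := by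
    refine ((hmono.tendsto_rightLim x).comp (tendsto_nhdsWithin_iff.2 ⟨?_, ?_⟩)).const_mul l
    · exact (Continuous.tendsto' (by fun_prop) _ _ (by simp)).mono_left nhdsWithin_le_nhds
    · filter_upwards [self_mem_nhdsWithin] with t ht
      exact lt_mul_of_one_lt_right hx (one_lt_pow₀ ht three_ne_zero)
  have sq_le : r ^ 2 ≤ l * r := ge_of_tendsto limit straddle
  by_contra! lt
  nlinarith [l_nonneg.trans_lt lt]

section MomentSequences

variable {K K' : Set ℝ} {s t : ℕ → ℝ}

theorem AdmissibleMeasure.isFiniteMeasure {μ : Measure ℝ} (hμ : AdmissibleMeasure μ) :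
    IsFiniteMeasure μ := by
  simpa [integrable_const_iff, isFiniteMeasure_iff] using hμ 0

theorem momentSequences_mono (h : K ⊆ K') : momentSequences K ⊆ momentSequences K' := by
  rintro s ⟨μ, hμ, hK, hs⟩
  exact ⟨μ, hμ, measure_mono_null (Set.compl_subset_compl.2 h) hK, hs⟩

theorem pow_mem_momentSequences {x : ℝ} (hx : x ∈ K) : (fun k => x ^ k) ∈ momentSequences K :=
  ⟨.dirac x, fun k => integrable_dirac (by simp), by simp [hx], fun k => by simp⟩

theorem const_mul_mem_momentSequences {c : ℝ} (hc : 0 ≤ c) (hs : s ∈ momentSequences K) :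
    (fun k => c * s k) ∈ momentSequences K := by
  obtain ⟨μ, hμ, hμK, hsμ⟩ := hs
  refine ⟨ENNReal.ofReal c • μ, fun k => (hμ k).smul_measure ENNReal.ofReal_ne_top, by simp [hμK],
    fun k => ?_⟩
  simp only [integral_smul_measure, ENNReal.toReal_ofReal hc, smul_eq_mul, hsμ]

theorem add_mem_momentSequences (hs : s ∈ momentSequences K) (ht : t ∈ momentSequences K) :
    (fun k => s k + t k) ∈ momentSequences K := by
  obtain ⟨μ, hμ, hμK, hsμ⟩ := hs
  obtain ⟨ν, hν, hνK, htν⟩ := ht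
  refine ⟨μ + ν, fun k => (hμ k).add_measure (hν k), by simp [hμK, hνK], fun k => ?_⟩
  simp only [integral_add_measure (hμ k) (hν k), hsμ, htν]

theorem momentSequences_union_subset {x : ℝ} (h0 : 0 ∈ K) (h1 : 1 ∈ K) (hx : x ∈ K) :
    momentSequences {1, x} ∪ momentSequences {0, 1} ⊆ momentSequences K :=
  Set.union_subset (momentSequences_mono (by simp [Set.insert_subset_iff, h1, hx]))
    (momentSequences_mono (by simp [Set.insert_subset_iff, h0, h1]))

theorem const_add_mul_pow_mem_momentSequences {a b x : ℝ} (ha : 0 ≤ a) (hb : 0 ≤ b) (h1 : 1 ∈ K)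
    (hx : x ∈ K) : (fun k => a + b * x ^ k) ∈ momentSequences K := by
  simpa using add_mem_momentSequences
    (const_mul_mem_momentSequences ha (pow_mem_momentSequences h1))
    (const_mul_mem_momentSequences hb (pow_mem_momentSequences hx))

theorem nonneg_of_mem_momentSequences (hK : K ⊆ Set.Ici 0) (hs : s ∈ momentSequences K) (k : ℕ) :
    0 ≤ s k := by
  obtain ⟨μ, -, hμK, hsμ⟩ := hs
  rw [hsμ]
  refine integral_nonneg_of_ae ?_
  filter_upwards [mem_ae_iff.2 hμK] with x hx using pow_nonneg (hK hx) k

theorem eq_mul_zero_pow_of_mem_momentSequences (hK : K ⊆ Set.Ici 0) (hs : s ∈ momentSequences K)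
    {k : ℕ} (hk : s k = 0) (j : ℕ) : s j = s 0 * 0 ^ j := by
  obtain ⟨μ, hμ, hμK, hsμ⟩ := hs
  have pow_nonneg_ae : 0 ≤ᵐ[μ] fun x : ℝ => x ^ k := by
    filter_upwards [mem_ae_iff.2 hμK] with x hx using pow_nonneg (hK hx) k
  have pow_eq_zero_ae := (integral_eq_zero_iff_of_nonneg_ae pow_nonneg_ae (hμ k)).1
    ((hsμ k).symm.trans hk)
  rw [hsμ j, hsμ 0, ← integral_mul_const]
  refine integral_congr_ae ?_
  filter_upwards [pow_eq_zero_ae] with x hx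
  simp [eq_zero_of_pow_eq_zero hx]

theorem hasSum_mem_momentSequences (hK : K ⊆ Set.Ici 0) {s : ℕ → ℕ → ℝ}
    (hs : ∀ n, s n ∈ momentSequences K) (ht : ∀ k, HasSum (fun n => s n k) (t k)) :
    t ∈ momentSequences K := by
  choose μ hμ hμK hsμ using hs
  have integral_norm : ∀ n k, ∫ x, ‖x ^ k‖ ∂(μ n) = s n k := fun n k => by
    rw [hsμ]
    refine integral_congr_ae ?_
    filter_upwards [mem_ae_iff.2 (hμK n)] with x hx using
      Real.norm_of_nonneg (pow_nonneg (hK hx) k)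
  have admissible : AdmissibleMeasure (.sum μ) := fun k =>
    integrable_sum_measure (fun n => hμ n k) (by simpa only [integral_norm] using (ht k).summable)
  refine ⟨.sum μ, admissible, Measure.sum_apply_eq_zero.2 hμK, fun k => ?_⟩
  simp only [integral_sum_measure (admissible k), ← hsμ]
  exact (ht k).tsum_eq.symm

theorem mul_mem_momentSequences {K : Subsemigroup ℝ} (hK : MeasurableSet (K : Set ℝ))
    (hs : s ∈ momentSequences K) (ht : t ∈ momentSequences K) :
    (fun k => s k * t k) ∈ momentSequences K := by
  obtain ⟨μ, hμ, hμK, hsμ⟩ := hs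
  obtain ⟨ν, hν, hνK, htν⟩ := ht
  have := hμ.isFiniteMeasure
  have := hν.isFiniteMeasure
  refine ⟨μ ∗ₘ ν, fun k => ?_, ?_, fun k => ?_⟩
  · rw [Measure.mconv, integrable_map_measure (by fun_prop) (by fun_prop)]
    simpa [Function.comp_def, mul_pow] using (hμ k).mul_prod (hν k)
  · rw [Measure.mconv, Measure.map_apply (by fun_prop) hK.compl]
    refine measure_mono_null (t := (K : Set ℝ)ᶜ ×ˢ Set.univ ∪ Set.univ ×ˢ (K : Set ℝ)ᶜ) ?_
      (measure_union_null (by simp [hμK]) (by simp [hνK]))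
    rintro ⟨x, y⟩ hxy
    by_contra! hmem
    simp only [Set.mem_union, Set.mem_prod, Set.mem_compl_iff, Set.mem_univ, and_true, true_and,
      not_or, not_not] at hmem
    exact hxy (K.mul_mem hmem.1 hmem.2)
  · rw [Measure.mconv, integral_map (by fun_prop) (by fun_prop)]
    simp only [mul_pow, hsμ, htν]
    exact (integral_prod_mul (fun x : ℝ => x ^ k) fun x : ℝ => x ^ k).symm

theorem pow_apply_mem_momentSequences {K : Submonoid ℝ} (hK : MeasurableSet (K : Set ℝ))
    (hs : s ∈ momentSequences K) (n : ℕ) : (fun k => s k ^ n) ∈ momentSequences K := by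
  induction n with
  | zero => simpa using pow_mem_momentSequences K.one_mem
  | succ n ih =>
    simp only [pow_succ]
    exact mul_mem_momentSequences (K := K.toSubsemigroup) hK ih hs

end MomentSequences

namespace MapsEntrywise

variable {F : ℝ≥0 → ℝ} {S S' T T' : Set (ℕ → ℝ)}

theorem mono (hF : MapsEntrywise F S T) (hS : S' ⊆ S) (hT : T ⊆ T') : MapsEntrywise F S' T' :=
  fun s hs => (hF s (hS hs)).imp fun _ h => ⟨h.1, hT h.2⟩

theorem comp_toNNReal_mem (hF : MapsEntrywise F S T) {s : ℕ → ℝ} (hs : s ∈ S) :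
    (fun k => F (s k).toNNReal) ∈ T := by
  obtain ⟨t, hts, hT⟩ := hF s hs
  simpa only [← hts, Real.toNNReal_coe] using hT

theorem hankel_quadratic_zero_one {K : Set ℝ}
    (hF : MapsEntrywise F (momentSequences {0, 1}) (momentSequences K)) {a b : ℝ≥0} (hab : a ≤ b)
    (x : ℝ) : 0 ≤ F b * x ^ 2 + 2 * F a * x + F a := by
  have := hankel_quadratic_nonneg (hF.comp_toNNReal_mem (const_add_mul_pow_mem_momentSequences
    (x := 0) a.coe_nonneg (sub_nonneg.2 (NNReal.coe_le_coe.2 hab)) (by simp) (by simp))) x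
  simpa [sq] using this

theorem nonneg {K : Set ℝ} (hF : MapsEntrywise F (momentSequences {0, 1}) (momentSequences K))
    (a : ℝ≥0) : 0 ≤ F a := by
  simpa using hF.hankel_quadratic_zero_one le_rfl (a := a) 0

theorem monotone {K : Set ℝ}
    (hF : MapsEntrywise F (momentSequences {0, 1}) (momentSequences K)) : Monotone F :=
  fun a b hab => by linarith [hF.hankel_quadratic_zero_one hab (-1)]

theorem sq_sqrt_mul_le {K : Set ℝ}
    (hF : MapsEntrywise F (momentSequences (Set.Icc 0 1)) (momentSequences K)) (a b : ℝ≥0) :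
    F (NNReal.sqrt (a * b)) ^ 2 ≤ F a * F b := by
  wlog hba : b ≤ a generalizing a b
  · rw [mul_comm a b, mul_comm (F a)]
    exact this b a (le_of_not_ge hba)
  rcases eq_or_ne a 0 with rfl | ha
  · simp [le_antisymm hba zero_le, sq]
  set x := NNReal.sqrt (b / a)
  have hx : (x : ℝ) ∈ Set.Icc 0 1 :=
    ⟨x.coe_nonneg, mod_cast NNReal.sqrt_le_one.2 (div_le_one_of_le₀ hba zero_le)⟩
  have geometric_mean : a * x = NNReal.sqrt (a * b) := by
    rw [← NNReal.sqrt_sq a, ← NNReal.sqrt_mul, NNReal.sqrt_sq]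
    congr 1
    field_simp
  have endpoint : a * x ^ 2 = b := by
    rw [NNReal.sq_sqrt]
    field_simp
  have := sq_le_mul_of_mem_momentSequences (hF.comp_toNNReal_mem
    (const_mul_mem_momentSequences a.coe_nonneg (pow_mem_momentSequences hx)))
  simp only [← NNReal.coe_pow, ← NNReal.coe_mul, Real.toNNReal_coe] at this
  rwa [pow_zero, mul_one, pow_one, geometric_mean, endpoint] at this

theorem hankelNonnegAt {u : ℝ} {K : Set ℝ}
    (hF : MapsEntrywise F (momentSequences {1, u}) (momentSequences K)) {a : ℝ} (ha : 0 ≤ a) :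
    HankelNonnegAt u (fun x => F x.toNNReal) a := fun _ hb q =>
  rieszFunctional_sq_nonneg (hF.comp_toNNReal_mem
    (const_add_mul_pow_mem_momentSequences ha hb.le (by simp) (by simp))) q

theorem hasNonnegPowerSeries {u : ℝ} (hu : Function.Injective fun k : ℕ => u ^ k) {K : Set ℝ}
    (hF : MapsEntrywise F (momentSequences {1, u} ∪ momentSequences {0, 1}) (momentSequences K))
    (hcont : ContinuousOn F (Set.Ioi 0)) : HasNonnegPowerSeries fun x => F x.toNNReal :=
  have hmono := (hF.mono Set.subset_union_right subset_rfl).monotone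
  hasNonnegPowerSeries_of_hankelNonnegAt hu
    (hmono.comp fun _ _ => Real.toNNReal_mono).locallyIntegrable
    (hcont.comp continuous_real_toNNReal.continuousOn fun _ => Real.toNNReal_pos.2)
    fun _ ha => (hF.mono Set.subset_union_left subset_rfl).hankelNonnegAt ha.le

theorem continuousOn_of_sq_sqrt_mul_le {K : Set ℝ}
    (hF : MapsEntrywise F (momentSequences {0, 1}) (momentSequences K))
    (hF_sq : ∀ a b, F (NNReal.sqrt (a * b)) ^ 2 ≤ F a * F b) : ContinuousOn F (Set.Ioi 0) :=
  continuousOn_of_monotone_of_sq_sqrt_mul_le hF.monotone (hF.nonneg 0) hF_sq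

theorem continuousOn_of_Icc {K : Set ℝ}
    (hF : MapsEntrywise F (momentSequences (Set.Icc 0 1)) (momentSequences K)) :
    ContinuousOn F (Set.Ioi 0) :=
  (hF.mono (momentSequences_mono (by simp [Set.insert_subset_iff])) subset_rfl)
    |>.continuousOn_of_sq_sqrt_mul_le hF.sq_sqrt_mul_le

end MapsEntrywise

theorem mapsEntrywise_of_hasNonnegPowerSeries {F : ℝ≥0 → ℝ}
    (hF : HasNonnegPowerSeries fun x => F x.toNNReal) (hF₀ : 0 ≤ F 0) (hF_min : ∀ x, F 0 ≤ F x)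
    {K : Submonoid ℝ} (hK : MeasurableSet (K : Set ℝ)) (hK_nonneg : (K : Set ℝ) ⊆ Set.Ici 0)
    (hK₀ : 0 ∈ K) : MapsEntrywise F (momentSequences K) (momentSequences K) := fun s hs => by
  obtain ⟨c, hc, hsum⟩ := hF
  have nonneg := nonneg_of_mem_momentSequences hK_nonneg hs
  refine ⟨fun k => (s k).toNNReal, fun k => Real.coe_toNNReal _ (nonneg k), ?_⟩
  -- The power series need not have the value `F 0` at `0`; a vanishing moment, however, means that
  -- the measure is a multiple of `δ₀`.
  by_cases vanishes : ∃ k, s k = 0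
  · obtain ⟨k, hk⟩ := vanishes
    have concentrated := eq_mul_zero_pow_of_mem_momentSequences hK_nonneg hs hk
    convert const_add_mul_pow_mem_momentSequences hF₀ (sub_nonneg.2 (hF_min (s 0).toNNReal))
      K.one_mem hK₀ with j
    rcases j with - | j
    · simp
    · simp [concentrated (j + 1)]
  · push Not at vanishes
    exact hasSum_mem_momentSequences hK_nonneg
      (fun n => const_mul_mem_momentSequences (hc n) (pow_apply_mem_momentSequences hK hs n))
      fun k => hsum (s k) ((nonneg k).lt_of_ne' (vanishes k))

section Characterizations

variable {F : ℝ≥0 → ℝ} {u : ℝ}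

theorem mapsEntrywise_two_point_iff (hu : 0 < u) (hu1 : u ≠ 1)
    (hcont : ContinuousOn F (Set.Ioi 0)) :
    MapsEntrywise F (momentSequences {1, u} ∪ momentSequences {0, 1})
        (momentSequences Set.univ) ↔
      (HasNonnegPowerSeries fun x => F x.toNNReal) ∧ 0 ≤ F 0 ∧ ∀ x, F 0 ≤ F x := by
  constructor
  · intro hF
    have hF01 := hF.mono Set.subset_union_right subset_rfl
    exact ⟨hF.hasNonnegPowerSeries (pow_right_injective₀ hu hu1) hcont, hF01.nonneg 0,
      fun x => hF01.monotone zero_le⟩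
  · rintro ⟨hF, hF₀, hF_min⟩
    exact (mapsEntrywise_of_hasNonnegPowerSeries (K := (Subsemiring.nonneg ℝ).toSubmonoid)
      hF hF₀ hF_min measurableSet_Ici subset_rfl (zero_mem (Subsemiring.nonneg ℝ))).mono
      (momentSequences_union_subset (zero_mem (Subsemiring.nonneg ℝ)) (one_mem _) hu.le)
      (momentSequences_mono (Set.subset_univ _))

theorem mapsEntrywise_Icc_iff :
    MapsEntrywise F (momentSequences (Set.Icc 0 1)) (momentSequences (Set.Icc 0 1)) ↔
      (HasNonnegPowerSeries fun x => F x.toNNReal) ∧ 0 ≤ F 0 ∧ ∀ x, F 0 ≤ F x := by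
  constructor
  · intro hF
    exact (mapsEntrywise_two_point_iff one_half_pos (by norm_num) hF.continuousOn_of_Icc).1 <|
      hF.mono (momentSequences_union_subset (by simp) (by simp) (by norm_num))
        (momentSequences_mono (Set.subset_univ _))
  · rintro ⟨hF, hF₀, hF_min⟩
    exact mapsEntrywise_of_hasNonnegPowerSeries (K := unitInterval.submonoid) hF hF₀ hF_min
      measurableSet_Icc Set.Icc_subset_Ici_self unitInterval.zero_mem

theorem mapsEntrywise_two_point_and_sq_sqrt_mul_le_iff (hu : 0 < u) (hu1 : u ≠ 1) :
    (MapsEntrywise F (momentSequences {1, u} ∪ momentSequences {0, 1})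
        (momentSequences Set.univ) ∧ ∀ a b, F (NNReal.sqrt (a * b)) ^ 2 ≤ F a * F b) ↔
      (HasNonnegPowerSeries fun x => F x.toNNReal) ∧ 0 ≤ F 0 ∧ ∀ x, F 0 ≤ F x := by
  constructor
  · rintro ⟨hF, hF_sq⟩
    have hF01 := hF.mono Set.subset_union_right subset_rfl
    exact (mapsEntrywise_two_point_iff hu hu1 (hF01.continuousOn_of_sq_sqrt_mul_le hF_sq)).1 hF
  · intro h
    have hF := mapsEntrywise_Icc_iff.2 h
    exact ⟨(mapsEntrywise_two_point_iff hu hu1 hF.continuousOn_of_Icc).2 h, hF.sq_sqrt_mul_le⟩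

end Characterizations

theorem theorem3p3_general (u₀ : ℝ) (hu₀ : 0 < u₀) (hu₁ : u₀ ≠ 1) (F : ℝ≥0 → ℝ) :
    [ MapsEntrywise F (momentSequences {1, u₀} ∪ momentSequences {0, 1})
          (momentSequences Set.univ) ∧
        ∀ a b : ℝ≥0, F a * F b ≥ F (NNReal.sqrt (a * b)) ^ 2,
      MapsEntrywise F (momentSequences (Set.Icc 0 1)) (momentSequences (Set.Icc 0 1)),
      (∃ G : ℂ → ℂ, IsAbsolutelyMonotonicEntire G ∧ ∀ x : ℝ≥0, 0 < x → (F x : ℂ) = G (x : ℝ)) ∧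
        ∃ L : ℝ, Filter.Tendsto F (𝓝[>] 0) (𝓝 L) ∧ 0 ≤ F 0 ∧ F 0 ≤ L ].TFAE ∧
    (ContinuousOn F (Set.Ioi 0) →
      [ MapsEntrywise F (momentSequences {1, u₀} ∪ momentSequences {0, 1})
            (momentSequences Set.univ),
        MapsEntrywise F (momentSequences (Set.Icc 0 1)) (momentSequences (Set.Icc 0 1)),
        (∃ G : ℂ → ℂ, IsAbsolutelyMonotonicEntire G ∧ ∀ x : ℝ≥0, 0 < x → (F x : ℂ) = G (x : ℝ)) ∧
          ∃ L : ℝ, Filter.Tendsto F (𝓝[>] 0) (𝓝 L) ∧ 0 ≤ F 0 ∧ F 0 ≤ L ].TFAE) := by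
  rw [exists_entire_and_tendsto_iff]
  constructor
  · tfae_have 1 ↔ 3 := mapsEntrywise_two_point_and_sq_sqrt_mul_le_iff hu₀ hu₁
    tfae_have 2 ↔ 3 := mapsEntrywise_Icc_iff
    tfae_finish
  · intro hcont
    tfae_have 1 ↔ 3 := mapsEntrywise_two_point_iff hu₀ hu₁ hcont
    tfae_have 2 ↔ 3 := mapsEntrywise_Icc_iff
    tfae_finish

theorem theorem3p3 (u₀ : ℝ) (hu₀ : 0 < u₀) (hu₁ : u₀ < 1) (F : ℝ≥0 → ℝ) :
    [ MapsEntrywise F (momentSequences {1, u₀} ∪ momentSequences {0, 1})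
          (momentSequences Set.univ) ∧
        ∀ a b : ℝ≥0, F a * F b ≥ F (NNReal.sqrt (a * b)) ^ 2,
      MapsEntrywise F (momentSequences (Set.Icc 0 1)) (momentSequences (Set.Icc 0 1)),
      (∃ G : ℂ → ℂ, IsAbsolutelyMonotonicEntire G ∧ ∀ x : ℝ≥0, 0 < x → (F x : ℂ) = G (x : ℝ)) ∧
        ∃ L : ℝ, Filter.Tendsto F (𝓝[>] 0) (𝓝 L) ∧ 0 ≤ F 0 ∧ F 0 ≤ L ].TFAE ∧
    (ContinuousOn F (Set.Ioi 0) →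
      [ MapsEntrywise F (momentSequences {1, u₀} ∪ momentSequences {0, 1})
            (momentSequences Set.univ),
        MapsEntrywise F (momentSequences (Set.Icc 0 1)) (momentSequences (Set.Icc 0 1)),
        (∃ G : ℂ → ℂ, IsAbsolutelyMonotonicEntire G ∧ ∀ x : ℝ≥0, 0 < x → (F x : ℂ) = G (x : ℝ)) ∧
          ∃ L : ℝ, Filter.Tendsto F (𝓝[>] 0) (𝓝 L) ∧ 0 ≤ F 0 ∧ F 0 ≤ L ].TFAE) := by
  exact theorem3p3_general u₀ hu₀ hu₁.ne F
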